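/- **Conventions.** A signature $\tau$ is a finite set of relation symbols $R$ with arities $\operatorname{ar}(R)\ge 1$. A $\tau$-structure $\mathfrak A$ consists of a (possibly empty) set $A$ and relations $R^{\mathfrak A}\subseteq A^{\operatorname{ar}(R)}$; for $B\subseteq A$, $\mathfrak A{\restriction}B$ is the induced substructure on $B$. $\mathsf{FO}(\exists^\infty)$ is first-order logic (with equality) over $\tau$ extended by the quantifier "there exist infinitely many". For a formula $\varphi(x,y_1,\dots,y_n)$ and $\bar s\in A^n$ let $\varphi^{\mathfrak A}(\cdot,\bar s)=\{a\in A : \mathfrak A\models\varphi(a,\bar s)\}$. **Tree-automatic structures.** For a finite alphabet $\Sigma$, a $\Sigma$-tree is a map $t:\operatorname{dom}(t)\to\Sigma$ whose domain is a finite (possibly empty) prefix-closed set of words over $\{0,1\}$. A (deterministic bottom-up) tree automaton has a finite set $Q$ of states, a start state $\iota\in Q$, a map $\delta:\Sigma\times Q\times Q\to Q$ and a set $F\subseteq Q$; it assigns the state $\iota$ to the empty tree and $\delta(a,q_0,q_1)$ to a tree with root label $a$ whose left and right subtrees are assigned $q_0$ and $q_1$, and it recognises the set of trees whose assigned state is in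 $F$. The convolution of $\Sigma$-trees $t_1,\dots,t_r$ is the tree over $(\Sigma\cup\{\Box\})^r$ with domain $\bigcup_i\operatorname{dom}(t_i)$ and label $(t_1(u),\dots,t_r(u))$ at $u$, where $t_i(u)=\Box$ if $u\notin\operatorname{dom}(t_i)$. A $\tau$-structure $\mathfrak A$ is tree-automatic if for some finite $\Sigma$ there is a bijection $\mu$ from $A$ onto a tree language recognised by some tree automaton such that for each $R$ the set of convolutions of the tuples $(\mu(a_1),\dots,\mu(a_r))$, $(a_1,\dots,a_r)\in R^{\mathfrak A}$, is recognised by some tree automaton. **Augmentations.** Let $m\ge 1$. $\mathfrak A$ is a *sum augmentation* of $\mathfrak B_1,\dots,\mathfrak B_m$ if $A$ is a disjoint union of (possibly empty) sets $A_1,\dots,A_m$ with $\mathfrak A{\restriction}A_i\cong\mathfrak B_i$ for each $i$. An *$R$-colouring* of $\mathfrak B$ is a map $c$ from $B^{\operatorname{ar}(R)}$ to a finite set such that $c(\bar t)\in c(R^{\mathfrak B})$ iff $\bar t\in R^{\mathfrak B}$. $\mathfrak A$ is a *tame box augmentation* of $\mathfrak B_1,\dots,\mathfrak B_m$ if there is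 a bijection $f:B_1\times\dots\times B_m\to A$ such that 1. for every $j$ and every choice of $x_i\in B_i$ ($i\ne j$), the map $b\mapsto f(x_1,\dots,x_{j-1},b,x_{j+1},\dots,x_m)$ is an embedding of $\mathfrak B_j$ into $\mathfrak A$; 2. for each relation symbol $R$, with $r=\operatorname{ar}(R)$, there are $R$-colourings $c_i:B_i^{r}\to Q_i$ of $\mathfrak B_i$ $(1\le i\le m)$ such that the map $A^{r}\to\prod_iQ_i$, $(f(\bar x_1),\dots,f(\bar x_r))\mapsto\bigl(c_i(x_{1,i},\dots,x_{r,i})\bigr)_{1\le i\le m}$, is an $R$-colouring of $\mathfrak A$. **Theorem (Delhommé).** Let $\mathfrak A$ be a tree-automatic $\tau$-structure and $\varphi(x,y_1,\dots,y_n)$, $n\ge 0$, an $\mathsf{FO}(\exists^\infty)$-formula over $\tau$. Then there exists a finite set $\mathcal S$ of tree-automatic $\tau$-structures such that for all $\bar s\in A^n$ the structure $\mathfrak A{\restriction}\varphi^{\mathfrak A}(\cdot,\bar s)$ is a sum augmentation of structures $\mathfrak C_1,\dots,\mathfrak C_m$ each of which is a tame box augmentation of members of $\mathcal S$. -/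

import Mathlib

open FirstOrder

universe u v w

namespace TreeAut

/-! ### Trees and tree automata -/

/-- The label of a `σ`-tree at the address `u ∈ {0,1}*` (`false` is `0`, going left, and `true`
is `1`, going right), or `none` if `u` is outside the domain of the tree.

A `σ`-tree is a map from a finite prefix-closed set of binary words to `σ`.  These maps are
represented by `BinaryTree σ`; `BinaryTree.nil` is the tree with empty domain, and the domain of
`t` is the set of all `u` with `label t u ≠ none`. -/
def label {σ : Type*} : BinaryTree σ → List Bool → Option σ
  | .nil, _ => none
  | .node a _ _, [] => some a
  | .node _ l _, false :: u => label l u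
  | .node _ _ r, true :: u => label r u

open Classical in
/-- The convolution of a tuple of `σ`-trees.  The padding symbol `□` is `none : Option σ`. -/
noncomputable def conv {σ : Type*} {n : ℕ} (t : Fin n → BinaryTree σ) :
    BinaryTree (Fin n → Option σ) :=
  if _h : ∀ i, t i = .nil then .nil
  else .node (fun i => label (t i) []) (conv fun i => (t i).left) (conv fun i => (t i).right)
termination_by ∑ i, (t i).numNodes
decreasing_by
  all_goals
    obtain ⟨i, hi⟩ := not_forall.mp ‹_›
    refine Finset.sum_lt_sum (fun j _ => ?_) ⟨i, Finset.mem_univ i, ?_⟩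
    · cases t j <;> simp only [BinaryTree.left, BinaryTree.right, BinaryTree.numNodes] <;> omega
    · cases hti : t i
      · exact absurd hti hi
      · simp only [BinaryTree.left, BinaryTree.right, BinaryTree.numNodes]; omega

theorem conv_of_nil {σ : Type*} {n : ℕ} {t : Fin n → BinaryTree σ} (h : ∀ i, t i = .nil) :
    conv t = .nil := by
  rw [conv, dif_pos h]

theorem conv_of_not_nil {σ : Type*} {n : ℕ} {t : Fin n → BinaryTree σ} (h : ¬ ∀ i, t i = .nil) :
    conv t = .node (fun i => label (t i) []) (conv fun i => (t i).left)
      (conv fun i => (t i).right) := by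
  rw [conv]
  exact dif_neg h

/-- The domain of a convolution is the union of the domains, and its label at an address `u` of
this union is the tuple of the labels at `u`, padded by `□`. -/
theorem label_conv {σ : Type*} {n : ℕ} (t : Fin n → BinaryTree σ) (u : List Bool)
    [Decidable (∀ i, label (t i) u = none)] :
    label (conv t) u =
      if ∀ i, label (t i) u = none then none else some fun i => label (t i) u := by
  classical
  by_cases h : ∀ i, t i = .nil
  · rw [conv_of_nil h, if_pos fun i => by rw [h i]; rfl]
    rfl
  rw [conv_of_not_nil h]
  cases u with
  | nil =>
    rw [if_neg]
    · rfl
    · refine fun h' => h fun i => ?_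
      have := h' i
      cases hti : t i with
      | nil => rfl
      | node a l r => rw [hti] at this; simp [label] at this
  | cons b u =>
    have e : ∀ i, label (t i) (b :: u) = label (bif b then (t i).right else (t i).left) u := by
      intro i
      cases t i <;> cases b <;> rfl
    simp only [e]
    cases b <;> simp only [cond_true, cond_false, label] <;> rw [label_conv]
termination_by u.length

/-- A deterministic bottom-up tree automaton over `σ`. -/
structure TreeAutomaton (σ : Type*) where
  /-- the set of states -/
  State : Type
  [finite_state : Finite State]
  /-- the start state -/
  init : State
  /-- the transition function -/
  step : σ → State → State → State
  /-- the set of accepting states -/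
  accept : Set State

/-- The state that an automaton reaches at the root of a tree. -/
def TreeAutomaton.run {σ : Type*} (M : TreeAutomaton σ) : BinaryTree σ → M.State
  | .nil => M.init
  | .node a l r => M.step a (M.run l) (M.run r)

/-- The tree language recognised by an automaton. -/
def TreeAutomaton.language {σ : Type*} (M : TreeAutomaton σ) : Set (BinaryTree σ) :=
  {t | M.run t ∈ M.accept}

/-- The automaton `M` recognises the relation `R` on trees. -/
def TreeAutomaton.Recognises {σ : Type*} {n : ℕ} (M : TreeAutomaton (Fin n → Option σ))
    (R : Set (Fin n → BinaryTree σ)) : Prop :=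
  M.language = conv '' R

/-! ### Tree-automatic structures -/

/-- The structure `A` admits a tree-automatic presentation: over some finite alphabet `σ` there are
automata `M` and `MR R`, one for each relation symbol, and a naming function `μ`, a bijection from
`A` onto the language of `M`, such that `MR R` recognises the image of `R` under `μ`. -/
def IsTreeAutomatic (L : Language) (A : Type*) [L.Structure A] : Prop :=
  ∃ (σ : Type) (_ : Finite σ) (M : TreeAutomaton σ)
    (MR : ∀ {r : ℕ}, L.Relations r → TreeAutomaton (Fin r → Option σ)) (μ : A → BinaryTree σ),
    Set.BijOn μ Set.univ M.language ∧
    ∀ {r : ℕ} (R : L.Relations r),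
      (MR R).Recognises ((fun x : Fin r → A => μ ∘ x) '' {x | Language.Structure.RelMap R x})

/-! ### First-order logic with the quantifier "there exist infinitely many" -/

/-- `FO(∃^∞)`-formulas with free variables in `α` and further variables in `Fin n`. -/
inductive InfFormula (L : Language) (α : Type) : ℕ → Type _
  | falsum {n : ℕ} : InfFormula L α n
  | equal {n : ℕ} (t₁ t₂ : L.Term (α ⊕ Fin n)) : InfFormula L α n
  | rel {n l : ℕ} (R : L.Relations l) (ts : Fin l → L.Term (α ⊕ Fin n)) : InfFormula L α n
  | imp {n : ℕ} (f₁ f₂ : InfFormula L α n) : InfFormula L α n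
  | all {n : ℕ} (f : InfFormula L α (n + 1)) : InfFormula L α n
  | exInf {n : ℕ} (f : InfFormula L α (n + 1)) : InfFormula L α n

/-- Satisfaction of an `FO(∃^∞)`-formula in a structure. -/
def InfFormula.Realize {L : Language} {α : Type} {A : Type*} [L.Structure A] :
    ∀ {n : ℕ}, InfFormula L α n → (α → A) → (Fin n → A) → Prop
  | _, falsum, _, _ => False
  | _, equal t₁ t₂, v, xs => t₁.realize (Sum.elim v xs) = t₂.realize (Sum.elim v xs)
  | _, rel R ts, v, xs => Language.Structure.RelMap R fun i => (ts i).realize (Sum.elim v xs)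
  | _, imp f₁ f₂, v, xs => Realize f₁ v xs → Realize f₂ v xs
  | _, all f, v, xs => ∀ a : A, Realize f v (Fin.snoc xs a)
  | _, exInf f, v, xs => {a : A | Realize f v (Fin.snoc xs a)}.Infinite

/-- The set `φ^A(·, s)` of all `a` with `A ⊨ φ(a, s)`, where the variable `x` of `φ(x, y₁, …, yₙ)`
has index `0` and `yᵢ` has index `i`. -/
def InfFormula.defSet {L : Language} {A : Type*} [L.Structure A] {n : ℕ}
    (φ : InfFormula L (Fin (n + 1)) 0) (s : Fin n → A) : Set A :=
  {a | φ.Realize (Fin.cons a s : Fin (n + 1) → A) Fin.elim0}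

/-! ### Sum augmentations and tame box augmentations -/

/-- The substructure of a relational structure `A` that is induced on a set `B ⊆ A`. -/
def induced (L : Language) [L.IsRelational] {A : Type*} [L.Structure A] (B : Set A) :
    L.Substructure A where
  carrier := B
  fun_mem f := isEmptyElim f

/-- `A` is a sum augmentation of `B₁, …, Bₙ`. -/
def IsSumAugmentation (L : Language) [L.IsRelational] (A : Type*) [L.Structure A] {n : ℕ}
    (B : Fin n → Type*) [∀ i, L.Structure (B i)] : Prop :=
  ∃ P : Fin n → Set A, Pairwise (Function.onFun Disjoint P) ∧ ⋃ i, P i = Set.univ ∧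
    ∀ i, Nonempty (induced L (P i) ≃[L] B i)

/-- The bijection `f` witnesses that `A` is a box augmentation of `B₁, …, Bₙ`: for all `j`, fixing
all coordinates but the `j`-th one yields an embedding of `B j` into `A`.  (The `j`-th entry of `x`
is irrelevant; it exists whenever `B j` is not empty.) -/
def IsBoxAugmentationVia (L : Language) (A : Type*) [L.Structure A] {n : ℕ}
    (B : Fin n → Type*) [∀ i, L.Structure (B i)] (f : (∀ i, B i) ≃ A) : Prop :=
  ∀ (j : Fin n) (x : ∀ i, B i), ∃ e : B j ↪[L] A, ∀ b, e b = f (Function.update x j b)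

/-- The map `c` into a set of colours is an `R`-colouring of `B`. -/
def IsColouring {L : Language} {B : Type*} [L.Structure B] {r : ℕ} (R : L.Relations r)
    {Q : Type*} (c : (Fin r → B) → Q) : Prop :=
  Finite Q ∧
    ∀ t : Fin r → B, c t ∈ c '' {t | Language.Structure.RelMap R t} ↔ Language.Structure.RelMap R t

/-- `A` is a tame box augmentation of `B₁, …, Bₙ`. -/
def IsTameBoxAugmentation (L : Language) (A : Type*) [L.Structure A] {n : ℕ}
    (B : Fin n → Type*) [∀ i, L.Structure (B i)] : Prop :=
  ∃ f : (∀ i, B i) ≃ A, IsBoxAugmentationVia L A B f ∧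
    ∀ {r : ℕ} (R : L.Relations r),
      ∃ (Q : Fin n → Type) (c : ∀ i, (Fin r → B i) → Q i),
        (∀ i, IsColouring R (c i)) ∧
        IsColouring R fun (t : Fin r → A) (i : Fin n) => c i fun k => f.symm (t k) i

end TreeAut

/-! The argument rests on finite congruences: maps on tuples of trees whose value is determined by
the root labels and the values at the left and right subtrees. Sets saturated by a congruence of
finite index are those recognised by automata, and they are closed under Boolean operations,
reindexing, `∃` and `∃^∞`. Hence `φ` is decided on names by one congruence `f` of the pair (x,
parameters) (`InfFormula.exists_isRegular`).

Fix the parameters and cut every tree x at a depth below which all parameter trees are empty. Above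
the cut there are only finitely many shapes for x. The subtrees hanging below it affect `f` only
through their `f`-value against empty parameters, which is part of a finite invariant `N`. Fixing
the shape and the `N`-class of every hanging subtree gives a slice, on which `φ` is constant
(`exists_slices`). So the definable set is a finite disjoint union of slices, whence the sum
augmentation.

A slice is a product of `N`-classes. By congruence, the state of a relation automaton on a tuple
from the slice depends only on its states on the component tuples, which gives tameness. If all
components but one are constant tuples, their states are fixed by their `N`-classes, because `N`
also records the states on constant tuples. Each factor is thus an `N`-class whose relations are
given by sets of accepted states (`IsSlice.exists_isTameBoxAugmentation`). The number of factors
grows with the parameters, but only finitely many such structures exist, and all are tree-automatic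
(`component_isTreeAutomatic`). -/

namespace TreeAut

/-! ### Finite congruences on tuples of trees -/

section Congruence

variable {σ ι κ : Type*}

/-- `f` is a congruence on tuples of trees: its value is determined by the tuple of root labels and
the values at the tuples of left and of right subtrees. -/
def IsCongruence {Q : Type*} (f : (ι → BinaryTree σ) → Q) : Prop :=
  ∀ t t' : ι → BinaryTree σ, (∀ i, label (t i) [] = label (t' i) []) →
    f (fun i => (t i).left) = f (fun i => (t' i).left) →
    f (fun i => (t i).right) = f (fun i => (t' i).right) → f t = f t'

/-- A set of tuples of trees is regular if it is saturated by a congruence of finite index. -/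
def IsRegular (X : Set (ι → BinaryTree σ)) : Prop :=
  ∃ (Q : Type) (_ : Finite Q) (f : (ι → BinaryTree σ) → Q) (F : Set Q),
    IsCongruence f ∧ X = f ⁻¹' F

/-- The tuple of trees with entry `x` at `none` and the entries of `t` elsewhere. -/
def extend (x : BinaryTree σ) (t : ι → BinaryTree σ) : Option ι → BinaryTree σ :=
  fun o => o.elim x t

theorem label_root_eq_none {t : BinaryTree σ} : label t [] = none ↔ t = .nil := by
  cases t <;> simp [label]

theorem eq_of_label_root_eq {t t' : BinaryTree σ} (h : label t [] = label t' [])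
    (hl : t.left = t'.left) (hr : t.right = t'.right) : t = t' := by
  cases t <;> cases t' <;> simp_all [label]

theorem left_extend (x : BinaryTree σ) (t : ι → BinaryTree σ) :
    (fun o => (extend x t o).left) = extend x.left fun i => (t i).left := by
  funext o; cases o <;> rfl

theorem right_extend (x : BinaryTree σ) (t : ι → BinaryTree σ) :
    (fun o => (extend x t o).right) = extend x.right fun i => (t i).right := by
  funext o; cases o <;> rfl

theorem IsCongruence.extend_eq {Q : Type*} {f : (Option ι → BinaryTree σ) → Q}
    (hf : IsCongruence f) {x x' : BinaryTree σ} {t t' : ι → BinaryTree σ}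
    (hx : label x [] = label x' []) (ht : ∀ i, label (t i) [] = label (t' i) [])
    (hl : f (extend x.left fun i => (t i).left) = f (extend x'.left fun i => (t' i).left))
    (hr : f (extend x.right fun i => (t i).right) = f (extend x'.right fun i => (t' i).right)) :
    f (extend x t) = f (extend x' t') := by
  apply hf
  · rintro (_ | i)
    exacts [hx, ht i]
  · simpa only [left_extend] using hl
  · simpa only [right_extend] using hr

theorem IsCongruence.comp {Q : Type*} {f : (κ → BinaryTree σ) → Q} (hf : IsCongruence f)
    (g : κ → ι) : IsCongruence fun t : ι → BinaryTree σ => f fun k => t (g k) :=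
  fun t t' h hl hr => hf (fun k => t (g k)) (fun k => t' (g k)) (fun k => h (g k)) hl hr

theorem IsCongruence.prodMk {Q Q' : Type*} {f : (ι → BinaryTree σ) → Q}
    {g : (ι → BinaryTree σ) → Q'} (hf : IsCongruence f) (hg : IsCongruence g) :
    IsCongruence fun t => (f t, g t) := by
  intro t t' h hl hr
  simp only [Prod.mk.injEq] at hl hr ⊢
  exact ⟨hf t t' h hl.1 hr.1, hg t t' h hl.2 hr.2⟩

theorem IsCongruence.pi {K : Type*} {Q : K → Type*} {f : ∀ k, (ι → BinaryTree σ) → Q k}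
    (hf : ∀ k, IsCongruence (f k)) : IsCongruence fun t k => f k t := by
  intro t t' h hl hr
  funext k
  exact hf k t t' h (congrFun hl k) (congrFun hr k)

theorem isCongruence_eq_nil (i : ι) :
    IsCongruence fun t : ι → BinaryTree σ => t i = .nil := by
  intro t t' h _ _
  simp only [← label_root_eq_none, h i]

/-! ### Closure of regular sets under reindexing, Boolean operations and quantifiers. -/

theorem IsRegular.comap {X : Set (κ → BinaryTree σ)} (hX : IsRegular X) (g : κ → ι) :
    IsRegular {t : ι → BinaryTree σ | (fun k => t (g k)) ∈ X} := by
  obtain ⟨Q, hQ, f, F, hf, rfl⟩ := hX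
  exact ⟨Q, hQ, _, F, hf.comp g, rfl⟩

theorem isRegular_empty : IsRegular (∅ : Set (ι → BinaryTree σ)) :=
  ⟨Unit, inferInstance, fun _ => (), ∅, fun _ _ _ _ _ => rfl, rfl⟩

theorem IsRegular.imp {X Y : Set (ι → BinaryTree σ)} (hX : IsRegular X) (hY : IsRegular Y) :
    IsRegular {t | t ∈ X → t ∈ Y} := by
  obtain ⟨Q, hQ, f, F, hf, rfl⟩ := hX
  obtain ⟨Q', hQ', g, G, hg, rfl⟩ := hY
  exact ⟨Q × Q', inferInstance, _, {p | p.1 ∈ F → p.2 ∈ G}, hf.prodMk hg, rfl⟩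

theorem IsRegular.compl {X : Set (ι → BinaryTree σ)} (hX : IsRegular X) : IsRegular Xᶜ :=
  hX.imp isRegular_empty

theorem IsRegular.inter {X Y : Set (ι → BinaryTree σ)} (hX : IsRegular X) (hY : IsRegular Y) :
    IsRegular (X ∩ Y) := by
  convert (hX.imp hY.compl).compl using 1
  ext t
  simp

theorem isRegular_eq (i j : ι) : IsRegular {t : ι → BinaryTree σ | t i = t j} := by
  refine ⟨Prop, inferInstance, fun t => t i = t j, {p | p}, ?_, rfl⟩
  have key : ∀ t : ι → BinaryTree σ, t i = t j ↔ label (t i) [] = label (t j) [] ∧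
      (t i).left = (t j).left ∧ (t i).right = (t j).right := fun t =>
    ⟨fun h => by rw [h]; exact ⟨rfl, rfl, rfl⟩, fun h => eq_of_label_root_eq h.1 h.2.1 h.2.2⟩
  intro t t' h hl hr
  simp only at hl hr
  simp only [key t, key t', h, hl, hr]

/-- The class of `(x, t)` with respect to `f`, refined so that it tells whether `x` is empty. -/
def refinedClass {Q : Type*} (f : (Option ι → BinaryTree σ) → Q) (t : ι → BinaryTree σ)
    (x : BinaryTree σ) : Q × Prop :=
  (f (extend x t), x = .nil)

theorem refinedClass_node {Q : Type*} {f : (Option ι → BinaryTree σ) → Q} (hf : IsCongruence f)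
    {t t' : ι → BinaryTree σ} (ht : ∀ i, label (t i) [] = label (t' i) []) (a : σ)
    {l r l' r' : BinaryTree σ}
    (hl : refinedClass f (fun i => (t' i).left) l' = refinedClass f (fun i => (t i).left) l)
    (hr : refinedClass f (fun i => (t' i).right) r' = refinedClass f (fun i => (t i).right) r) :
    refinedClass f t' (.node a l' r') = refinedClass f t (.node a l r) := by
  simp only [refinedClass, Prod.mk.injEq] at hl hr ⊢
  exact ⟨hf.extend_eq rfl (fun i => (ht i).symm) hl.1 hr.1, by simp⟩

/-- Here the refinement is needed: the subtrees of the empty tree are empty, and a tree in the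
refined class of an empty one must itself be empty, so the values of `f` at the subtrees can be
compared. -/
theorem refinedClass_nil {Q : Type*} {f : (Option ι → BinaryTree σ) → Q} (hf : IsCongruence f)
    {t t' : ι → BinaryTree σ} (ht : ∀ i, label (t i) [] = label (t' i) [])
    {l r : BinaryTree σ}
    (hl : refinedClass f (fun i => (t' i).left) l = refinedClass f (fun i => (t i).left) .nil)
    (hr : refinedClass f (fun i => (t' i).right) r = refinedClass f (fun i => (t i).right) .nil) :
    refinedClass f t' .nil = refinedClass f t .nil := by
  simp only [refinedClass, Prod.mk.injEq, eq_iff_iff, iff_true] at hl hr ⊢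
  obtain ⟨hl, rfl⟩ := hl
  obtain ⟨hr, rfl⟩ := hr
  exact ⟨hf.extend_eq rfl (fun i => (ht i).symm) hl hr, trivial⟩

/-- For each class of pairs `(x, t)` record whether it is attained, and whether it is attained
infinitely often, as `x` varies. -/
def fibreSizes {Q : Type*} (f : (Option ι → BinaryTree σ) → Q) (t : ι → BinaryTree σ) :
    Set (Q × Prop) × Set (Q × Prop) :=
  ({p | ∃ x, refinedClass f t x = p}, {p | {x | refinedClass f t x = p}.Infinite})

theorem IsCongruence.exists_refinedClass {Q : Type*} {f : (Option ι → BinaryTree σ) → Q}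
    (hf : IsCongruence f) {t t' : ι → BinaryTree σ}
    (ht : ∀ i, label (t i) [] = label (t' i) [])
    (hl : fibreSizes f (fun i => (t i).left) = fibreSizes f (fun i => (t' i).left))
    (hr : fibreSizes f (fun i => (t i).right) = fibreSizes f (fun i => (t' i).right))
    (x : BinaryTree σ) : ∃ y, refinedClass f t' y = refinedClass f t x := by
  have h₁ : ∀ z, ∃ y, refinedClass f (fun i => (t' i).left) y =
      refinedClass f (fun i => (t i).left) z := fun z =>
    (Set.ext_iff.1 (congrArg Prod.fst hl) _).1 ⟨z, rfl⟩
  have h₂ : ∀ z, ∃ y, refinedClass f (fun i => (t' i).right) y =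
      refinedClass f (fun i => (t i).right) z := fun z =>
    (Set.ext_iff.1 (congrArg Prod.fst hr) _).1 ⟨z, rfl⟩
  cases x with
  | nil =>
    obtain ⟨l, hl⟩ := h₁ .nil
    obtain ⟨r, hr⟩ := h₂ .nil
    exact ⟨.nil, refinedClass_nil hf ht hl hr⟩
  | node a l r =>
    obtain ⟨l', hl⟩ := h₁ l
    obtain ⟨r', hr⟩ := h₂ r
    exact ⟨.node a l' r', refinedClass_node hf ht a hl hr⟩

/-- Up to a finite partition, an infinite fibre is a set of nodes with fixed root label and fixed
classes of both subtrees, hence embeds in a product of two fibres. A product is infinite iff one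
factor is infinite and the other nonempty, so attainment and infinitude must be recorded together.
-/
theorem IsCongruence.infinite_refinedClass [Finite σ] {Q : Type*} [Finite Q]
    {f : (Option ι → BinaryTree σ) → Q} (hf : IsCongruence f) {t t' : ι → BinaryTree σ}
    (ht : ∀ i, label (t i) [] = label (t' i) [])
    (hl : fibreSizes f (fun i => (t i).left) = fibreSizes f (fun i => (t' i).left))
    (hr : fibreSizes f (fun i => (t i).right) = fibreSizes f (fun i => (t' i).right))
    {p : Q × Prop} (hp : {x | refinedClass f t x = p}.Infinite) :
    {x | refinedClass f t' x = p}.Infinite := by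
  let g : BinaryTree σ → Option σ × (Q × Prop) × (Q × Prop) := fun x =>
    (label x [], refinedClass f (fun i => (t i).left) x.left,
      refinedClass f (fun i => (t i).right) x.right)
  -- Pigeonhole over the finitely many values of `g`; an empty root label is then excluded, since
  -- only the empty tree has it.
  obtain ⟨⟨o, pl, pr⟩, hinf⟩ : ∃ c, ({x | refinedClass f t x = p} ∩ g ⁻¹' {c}).Infinite := by
    by_contra! h
    refine hp ((Set.finite_iUnion h).subset fun x hx => ?_)
    exact Set.mem_iUnion.2 ⟨g x, hx, rfl⟩
  obtain ⟨x, hx⟩ := hinf.nonempty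
  simp only [g, Set.mem_inter_iff, Set.mem_ofPred_eq, Set.mem_preimage, Set.mem_singleton_iff,
    Prod.mk.injEq] at hx
  obtain ⟨hxp, hxo, hxl, hxr⟩ := hx
  cases o with
  | none =>
    refine absurd ((Set.finite_singleton BinaryTree.nil).subset ?_) hinf
    rintro y ⟨-, hy⟩
    exact label_root_eq_none.1 (congrArg Prod.fst hy)
  | some a =>
    obtain rfl | ⟨l, r, rfl⟩ : x = .nil ∨ ∃ l r, x = .node a l r := by
      cases x with
      | nil => exact Or.inl rfl
      | node b l r => cases hxo; exact Or.inr ⟨l, r, rfl⟩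
    · simp [label] at hxo
    simp only [BinaryTree.left, BinaryTree.right] at hxl hxr
    have hprod : ({y | refinedClass f (fun i => (t i).left) y = pl} ×ˢ
        {z | refinedClass f (fun i => (t i).right) z = pr}).Infinite := by
      refine Set.infinite_of_injOn_mapsTo (f := fun x => (x.left, x.right)) ?_ ?_ hinf
      · rintro y ⟨-, hy⟩ z ⟨-, hz⟩ h
        exact eq_of_label_root_eq ((congrArg Prod.fst hy).trans (congrArg Prod.fst hz).symm)
          (congrArg Prod.fst h) (congrArg Prod.snd h)
      · rintro y ⟨-, hy⟩
        exact ⟨(Prod.mk.inj (Prod.mk.inj hy).2).1, (Prod.mk.inj (Prod.mk.inj hy).2).2⟩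
    have hprod' : ({y | refinedClass f (fun i => (t' i).left) y = pl} ×ˢ
        {z | refinedClass f (fun i => (t' i).right) z = pr}).Infinite := by
      rw [Set.infinite_prod] at hprod ⊢
      have e₁ := Set.ext_iff.1 (congrArg Prod.fst hl) pl
      have e₂ := Set.ext_iff.1 (congrArg Prod.snd hl) pl
      have e₃ := Set.ext_iff.1 (congrArg Prod.fst hr) pr
      have e₄ := Set.ext_iff.1 (congrArg Prod.snd hr) pr
      exact hprod.imp (And.imp e₂.1 e₃.1) (And.imp e₄.1 e₁.1)
    refine Set.infinite_of_injOn_mapsTo (f := fun y => BinaryTree.node a y.1 y.2) ?_ ?_ hprod'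
    · rintro ⟨y, z⟩ - ⟨y', z'⟩ - h
      simpa using h
    · rintro ⟨y, z⟩ ⟨hy, hz⟩
      exact (refinedClass_node hf ht a (hy.trans hxl.symm) (hz.trans hxr.symm)).trans hxp

theorem IsCongruence.fibreSizes [Finite σ] {Q : Type*} [Finite Q]
    {f : (Option ι → BinaryTree σ) → Q} (hf : IsCongruence f) :
    IsCongruence (fibreSizes f) := by
  intro t t' ht hl hr
  have ht' := fun i => (ht i).symm
  refine Prod.ext (Set.ext fun p => ?_) (Set.ext fun p => ?_)
  · constructor
    · rintro ⟨x, rfl⟩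
      exact hf.exists_refinedClass ht hl hr x
    · rintro ⟨x, rfl⟩
      exact hf.exists_refinedClass ht' hl.symm hr.symm x
  · exact ⟨hf.infinite_refinedClass ht hl hr, hf.infinite_refinedClass ht' hl.symm hr.symm⟩

theorem IsRegular.exists [Finite σ] {X : Set (Option ι → BinaryTree σ)} (hX : IsRegular X) :
    IsRegular {t | ∃ x, extend x t ∈ X} := by
  obtain ⟨Q, hQ, f, F, hf, rfl⟩ := hX
  refine ⟨_, inferInstance, _, {c | ∃ p ∈ c.1, p.1 ∈ F}, hf.fibreSizes, ?_⟩
  ext t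
  constructor
  · rintro ⟨x, hx⟩
    exact ⟨_, ⟨x, rfl⟩, hx⟩
  · rintro ⟨_, ⟨x, rfl⟩, hx⟩
    exact ⟨x, hx⟩

theorem IsRegular.infinite [Finite σ] {X : Set (Option ι → BinaryTree σ)} (hX : IsRegular X) :
    IsRegular {t | {x | extend x t ∈ X}.Infinite} := by
  obtain ⟨Q, hQ, f, F, hf, rfl⟩ := hX
  refine ⟨_, inferInstance, _, {c | ∃ p ∈ c.2, p.1 ∈ F}, hf.fibreSizes, ?_⟩
  ext t
  constructor
  · intro h
    obtain ⟨p, hp⟩ : ∃ p, ({x | f (extend x t) ∈ F} ∩ refinedClass f t ⁻¹' {p}).Infinite := by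
      by_contra! h'
      refine h ((Set.finite_iUnion h').subset fun x hx => ?_)
      exact Set.mem_iUnion.2 ⟨refinedClass f t x, hx, rfl⟩
    obtain ⟨x, hx, rfl⟩ := hp.nonempty
    exact ⟨refinedClass f t x, hp.mono fun y hy => hy.2, hx⟩
  · rintro ⟨p, hp, hF⟩
    refine hp.mono ?_
    rintro x rfl
    exact hF

theorem IsRegular.forall [Finite σ] {X : Set (Option ι → BinaryTree σ)} (hX : IsRegular X) :
    IsRegular {t | ∀ x, extend x t ∈ X} := by
  convert hX.compl.exists.compl using 1
  ext t
  simp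

end Congruence
/-! ### Automata and congruences -/

section Automata

variable {σ : Type*} {r : ℕ}

/-- A map on trees that is compatible with the tree structure and takes finitely many values is
computed by an automaton. -/
theorem exists_automaton {Q : Type*} [Finite Q] (f : BinaryTree σ → Q)
    (hf : ∀ a l r l' r', f l = f l' → f r = f r' → f (.node a l r) = f (.node a l' r'))
    (F : Set Q) : ∃ M : TreeAutomaton σ, M.language = f ⁻¹' F := by
  classical
  -- States must live in `Type`, so `Q` is replaced by `Fin k`. Pairs of states not attained by
  -- trees get an arbitrary successor.
  obtain ⟨k, ⟨e⟩⟩ := Finite.exists_equiv_fin Q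
  let step : σ → Fin k → Fin k → Fin k := fun a p q =>
    if h : ∃ t : BinaryTree σ × BinaryTree σ, e (f t.1) = p ∧ e (f t.2) = q then
      e (f (.node a h.choose.1 h.choose.2)) else e (f .nil)
  let M : TreeAutomaton σ :=
    { State := Fin k
      init := e (f .nil)
      step := step
      accept := {q | e.symm q ∈ F} }
  have run : ∀ t, M.run t = e (f t) := by
    intro t
    induction t with
    | nil => rfl
    | node a l r hl hr =>
      have h : ∃ t : BinaryTree σ × BinaryTree σ, e (f t.1) = e (f l) ∧ e (f t.2) = e (f r) :=
        ⟨(l, r), rfl, rfl⟩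
      change step a (M.run l) (M.run r) = _
      rw [hl, hr]
      simp only [step]
      rw [dif_pos h]
      exact congrArg e (hf _ _ _ _ _ (e.injective h.choose_spec.1) (e.injective h.choose_spec.2))
  refine ⟨M, ?_⟩
  ext t
  change e.symm (M.run t) ∈ F ↔ f t ∈ F
  rw [run, e.symm_apply_apply]

/-- The tuple of trees described by a tree over the convolution alphabet. -/
def decode : BinaryTree (Fin r → Option σ) → Fin r → BinaryTree σ
  | .nil, _ => .nil
  | .node a l r, i => (a i).elim .nil fun b => .node b (decode l i) (decode r i)

theorem conv_eq_nil {t : Fin r → BinaryTree σ} : conv t = .nil ↔ ∀ i, t i = .nil := by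
  refine ⟨fun h => by_contra fun h' => ?_, conv_of_nil⟩
  rw [conv_of_not_nil h'] at h
  cases h

theorem decode_conv (t : Fin r → BinaryTree σ) : decode (conv t) = t := by
  generalize hτ : conv t = τ
  induction τ generalizing t with
  | nil => funext i; exact (conv_eq_nil.1 hτ i).symm
  | node a l r hl hr =>
    have h : ¬ ∀ i, t i = .nil := fun h => by rw [conv_of_nil h] at hτ; cases hτ
    rw [conv_of_not_nil h] at hτ
    obtain ⟨rfl, hl', hr'⟩ := BinaryTree.node.inj hτ
    funext i
    simp only [decode, hl _ hl', hr _ hr']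
    cases t i <;> rfl

theorem conv_injective : Function.Injective (conv : (Fin r → BinaryTree σ) → _) :=
  Function.LeftInverse.injective decode_conv

theorem label_decode_root (a : Fin r → Option σ) (l r') (i : Fin r) :
    label (decode (.node a l r') i) [] = a i := by
  cases h : a i <;> simp [decode, h, label]

/-- A local test for being a convolution: no label is all padding, and nothing continues below a
padded position. It lets an automaton reject the trees that are not convolutions. -/
theorem conv_decode_node {a : Fin r → Option σ} {l r' : BinaryTree (Fin r → Option σ)} :
    conv (decode (.node a l r')) = .node a l r' ↔
      (∃ i, a i ≠ none) ∧ conv (decode l) = l ∧ conv (decode r') = r' ∧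
        ∀ i, a i = none → decode l i = .nil ∧ decode r' i = .nil := by
  have hnil : ∀ i, decode (.node a l r') i = .nil ↔ a i = none := fun i => by
    rw [← label_root_eq_none, label_decode_root]
  constructor
  · intro h
    have h₀ : ¬ ∀ i, decode (.node a l r') i = .nil := fun h' => by
      rw [conv_of_nil h'] at h; cases h
    rw [conv_of_not_nil h₀] at h
    obtain ⟨-, hl, hr⟩ := BinaryTree.node.inj h
    have hl' := (decode_conv _).symm.trans (congrArg decode hl)
    have hr' := (decode_conv _).symm.trans (congrArg decode hr)
    simp only [hnil, not_forall] at h₀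
    refine ⟨h₀, hl' ▸ hl, hr' ▸ hr, fun i hi => ?_⟩
    have hi' := (hnil i).2 hi
    exact ⟨(congrFun hl' i).symm.trans (congrArg BinaryTree.left hi'),
      (congrFun hr' i).symm.trans (congrArg BinaryTree.right hi')⟩
  · rintro ⟨⟨i, hi⟩, hl, hr, hn⟩
    have h₀ : ¬ ∀ i, decode (.node a l r') i = .nil := fun h' => hi ((hnil i).1 (h' i))
    have hl' : (fun i => (decode (.node a l r') i).left) = decode l := by
      funext i
      cases h : a i <;> simp [decode, h, hn]
    have hr' : (fun i => (decode (.node a l r') i).right) = decode r' := by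
      funext i
      cases h : a i <;> simp [decode, h, hn]
    rw [conv_of_not_nil h₀, hl', hr', hl, hr]
    simp only [label_decode_root]

open Classical in
/-- A regular set of tuples is recognised by an automaton. -/
theorem IsRegular.exists_recognises {X : Set (Fin r → BinaryTree σ)} (hX : IsRegular X) :
    ∃ M : TreeAutomaton (Fin r → Option σ), M.Recognises X := by
  obtain ⟨Q, hQ, f, F, hf, rfl⟩ := hX
  -- The first entry is `none` on trees that are not convolutions; the second records the empty
  -- coordinates, which the local test at the parent requires.
  let g : BinaryTree (Fin r → Option σ) → Option Q × Set (Fin r) := fun τ =>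
    (if conv (decode τ) = τ then some (f (decode τ)) else none, {i | decode τ i = .nil})
  have key : ∀ τ τ', g τ = g τ' → (conv (decode τ) = τ ↔ conv (decode τ') = τ') ∧
      (conv (decode τ) = τ → f (decode τ) = f (decode τ')) ∧
      ∀ i, decode τ i = .nil ↔ decode τ' i = .nil := by
    intro τ τ' h
    obtain ⟨h₁, h₂⟩ := Prod.mk.inj h
    refine ⟨?_, ?_, fun i => Set.ext_iff.1 h₂ i⟩
    · by_cases c : conv (decode τ) = τ <;> by_cases c' : conv (decode τ') = τ' <;> simp_all
    · intro c
      by_cases c' : conv (decode τ') = τ' <;> simp_all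
  obtain ⟨M, hM⟩ := exists_automaton g (by
    intro a l r l' r' hl hr
    obtain ⟨l₁, l₂, l₃⟩ := key _ _ hl
    obtain ⟨r₁, r₂, r₃⟩ := key _ _ hr
    have hv : conv (decode (.node a l r)) = .node a l r ↔
        conv (decode (.node a l' r')) = .node a l' r' := by
      simp only [conv_decode_node, l₁, r₁, l₃, r₃]
    have hs : ∀ i, decode (.node a l r) i = .nil ↔ decode (.node a l' r') i = .nil := fun i => by
      simp only [← label_root_eq_none, label_decode_root]
    have hleft : ∀ {l r : BinaryTree (Fin _ → Option σ)},
        conv (decode (.node a l r)) = .node a l r →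
        (fun i => (decode (.node a l r) i).left) = decode l ∧
        (fun i => (decode (.node a l r) i).right) = decode r := by
      intro l r h
      have hn := (conv_decode_node.1 h).2.2.2
      constructor <;>
      · funext i
        cases h : a i <;> simp [decode, h, hn]
    refine Prod.ext ?_ (Set.ext hs)
    by_cases c : conv (decode (.node a l r)) = .node a l r
    · have c' := hv.1 c
      simp only [g, if_pos c, if_pos c', Option.some.injEq]
      obtain ⟨-, cl, cr, -⟩ := conv_decode_node.1 c
      apply hf
      · simp only [label_decode_root, implies_true]
      · rw [(hleft c).1, (hleft c').1, l₂ cl]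
      · rw [(hleft c).2, (hleft c').2, r₂ cr]
    · simp only [g, if_neg c, if_neg (mt hv.2 c)]) {p | ∃ q ∈ F, p.1 = some q}
  refine ⟨M, ?_⟩
  rw [TreeAutomaton.Recognises, hM]
  ext τ
  constructor
  · rintro ⟨q, hq, h⟩
    by_cases c : conv (decode τ) = τ
    · simp only [g, if_pos c, Option.some.injEq] at h
      exact ⟨decode τ, (show f (decode τ) ∈ F from h ▸ hq), c⟩
    · simp [g, if_neg c] at h
  · rintro ⟨t, ht, rfl⟩
    refine ⟨f t, ht, ?_⟩
    simp [g, decode_conv]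

/-- The state reached on the convolution of a tuple is a congruence. -/
theorem TreeAutomaton.isCongruence_conv (M : TreeAutomaton (Fin r → Option σ)) :
    IsCongruence fun t : Fin r → BinaryTree σ => M.run (conv t) := by
  intro t t' h hl hr
  by_cases c : ∀ i, t i = .nil
  · have c' : ∀ i, t' i = .nil := fun i => by
      rw [← label_root_eq_none, ← h i, label_root_eq_none, c i]
    simp only [conv_of_nil c, conv_of_nil c']
  · have c' : ¬ ∀ i, t' i = .nil := fun c' => c fun i => by
      rw [← label_root_eq_none, h i, label_root_eq_none, c' i]
    simp only [conv_of_not_nil c, conv_of_not_nil c', TreeAutomaton.run, h] at hl hr ⊢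
    rw [hl, hr]

theorem TreeAutomaton.isRegular_language {ι : Type*} (M : TreeAutomaton σ) (i : ι) :
    IsRegular {t : ι → BinaryTree σ | t i ∈ M.language} := by
  have := M.finite_state
  refine ⟨M.State, inferInstance, fun t => M.run (t i), M.accept, ?_, rfl⟩
  intro t t' h hl hr
  have hi := h i
  cases ht : t i <;> cases ht' : t' i <;> simp_all [label, TreeAutomaton.run]

theorem TreeAutomaton.Recognises.run_mem_iff {M : TreeAutomaton (Fin r → Option σ)}
    {X : Set (Fin r → BinaryTree σ)} (hM : M.Recognises X) (t : Fin r → BinaryTree σ) :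
    M.run (conv t) ∈ M.accept ↔ t ∈ X := by
  change conv t ∈ M.language ↔ _
  rw [hM, conv_injective.mem_set_image]

theorem TreeAutomaton.Recognises.isRegular {M : TreeAutomaton (Fin r → Option σ)}
    {X : Set (Fin r → BinaryTree σ)} (hM : M.Recognises X) : IsRegular X :=
  ⟨M.State, M.finite_state, _, M.accept, M.isCongruence_conv,
    Set.ext fun t => (hM.run_mem_iff t).symm⟩

end Automata

/-! ### Formulas define regular sets -/

theorem InfFormula.exists_isRegular {L : FirstOrder.Language.{u, v}} [L.IsRelational] {A : Type w}
    [L.Structure A] {σ : Type} [Finite σ] {M : TreeAutomaton σ} {μ : A → BinaryTree σ}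
    (hμ : Set.BijOn μ Set.univ M.language)
    (hR : ∀ {r : ℕ} (R : L.Relations r), IsRegular
      ((fun x : Fin r → A => μ ∘ x) '' {x | Language.Structure.RelMap R x}))
    {α : Type} {k : ℕ} (φ : InfFormula L α k) :
    ∃ X : Set (α ⊕ Fin k → BinaryTree σ), IsRegular X ∧
      ∀ v xs, (fun i => μ (Sum.elim v xs i)) ∈ X ↔ φ.Realize v xs := by
  have hinj : Function.Injective μ := Set.injOn_univ.1 hμ.injOn
  have hterm : ∀ {k : ℕ} (t : L.Term (α ⊕ Fin k)), ∃ i, t = .var i := by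
    rintro k (i | ⟨f, -⟩)
    exacts [⟨i, rfl⟩, isEmptyElim f]
  have hext : ∀ {k : ℕ}, ∃ g : α ⊕ Fin (k + 1) → Option (α ⊕ Fin k), ∀ (v : α → A) xs a,
      (fun i => extend (μ a) (fun i => μ (Sum.elim v xs i)) (g i)) =
        fun i => μ (Sum.elim v (Fin.snoc xs a : Fin (k + 1) → A) i) := by
    intro k
    refine ⟨Sum.elim (fun a => some (.inl a)) (Fin.snoc (fun i => some (.inr i)) none), ?_⟩
    intro v xs a
    funext i
    rcases i with i | i
    · rfl
    · refine Fin.lastCases ?_ (fun i => ?_) i <;> simp [extend]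
  induction φ with
  | falsum => exact ⟨∅, isRegular_empty, fun _ _ => Iff.rfl⟩
  | equal t₁ t₂ =>
    obtain ⟨i, rfl⟩ := hterm t₁
    obtain ⟨j, rfl⟩ := hterm t₂
    exact ⟨_, isRegular_eq i j, fun v xs => hinj.eq_iff⟩
  | @rel n l R ts =>
    choose i hi using fun j => hterm (ts j)
    refine ⟨_, (hR R).comap i, fun v xs => ?_⟩
    have hc : Function.Injective fun x : Fin l → A => μ ∘ x := hinj.comp_left
    simp only [InfFormula.Realize, hi]
    exact hc.mem_set_image (a := fun j => Sum.elim v xs (i j))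
  | imp f₁ f₂ h₁ h₂ =>
    obtain ⟨X, hX, h₁⟩ := h₁
    obtain ⟨Y, hY, h₂⟩ := h₂
    exact ⟨_, hX.imp hY, fun v xs => imp_congr (h₁ v xs) (h₂ v xs)⟩
  | all f h =>
    obtain ⟨X, hX, h⟩ := h
    obtain ⟨g, hg⟩ := hext
    -- Not every tree is a name, so quantifiers are relativised to the language of `M`.
    refine ⟨_, ((M.isRegular_language none).imp (hX.comap g)).forall, fun v xs => ?_⟩
    simp only [Set.mem_ofPred_eq, InfFormula.Realize, ← h]
    constructor
    · intro H a
      rw [← hg]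
      exact H (μ a) (hμ.mapsTo trivial)
    · intro H x hx
      obtain ⟨a, -, rfl⟩ := hμ.surjOn hx
      rw [hg]
      exact H a
  | exInf f h =>
    obtain ⟨X, hX, h⟩ := h
    obtain ⟨g, hg⟩ := hext
    refine ⟨_, ((M.isRegular_language none).inter (hX.comap g)).infinite, fun v xs => ?_⟩
    simp only [InfFormula.Realize, ← h]
    rw [← Set.infinite_image_iff hinj.injOn]
    refine iff_of_eq (congrArg Set.Infinite (Set.ext fun x => ?_))
    constructor
    · rintro ⟨hx, hX⟩
      obtain ⟨a, -, rfl⟩ := hμ.surjOn hx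
      exact ⟨a, by simpa only [Set.mem_ofPred_eq, hg] using hX, rfl⟩
    · rintro ⟨a, ha, rfl⟩
      exact ⟨hμ.mapsTo trivial, by simpa only [Set.mem_ofPred_eq, hg] using ha⟩

/-! ### Slices -/

section Slices

variable {L : FirstOrder.Language.{u, v}} {σ : Type} {I : Type} {Q : ∀ r, L.Relations r → Type}
  (c : ∀ r (R : L.Relations r), (Fin r → BinaryTree σ) → Q r R) (N : BinaryTree σ → I)

/-- A slice is a set of trees in bijection with a nonempty finite product of classes of `N` (or
empty sets), such that the colour `c r R` of a tuple of trees in the slice is determined by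
the colours of the components of this tuple. -/
def IsSlice (X : Set (BinaryTree σ)) : Prop :=
  ∃ (k : ℕ) (typ : Fin k → Option I) (fill : (Fin k → BinaryTree σ) → BinaryTree σ), 0 < k ∧
    Set.BijOn fill {x | ∀ j, some (N (x j)) = typ j} X ∧
    ∀ r (R : L.Relations r) (x x' : Fin r → Fin k → BinaryTree σ),
      (∀ j, c r R (fun i => x i j) = c r R fun i => x' i j) →
      c r R (fun i => fill (x i)) = c r R fun i => fill (x' i)

theorem isSlice_class (i : Option I) : IsSlice c N {t | some (N t) = i} := by
  refine ⟨1, fun _ => i, fun x => x 0, one_pos, ⟨fun x hx => hx 0, ?_, ?_⟩,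
    fun r R x x' h => h 0⟩
  · intro x _ y _ h
    funext j
    rw [Subsingleton.elim j 0]
    exact h
  · intro t ht
    exact ⟨fun _ => t, fun _ => ht, rfl⟩

variable {c N}

/-- The set of trees with root label `a` and immediate subtrees in `X` and `Y`. -/
def nodeSet (a : σ) (X Y : Set (BinaryTree σ)) : Set (BinaryTree σ) :=
  {t | ∃ l ∈ X, ∃ r ∈ Y, t = .node a l r}

/-- Concatenate the coordinates of both slices. All trees have root label `a`, so the congruence
property computes the colour of a tuple from the colours of its left and right subtrees. -/
theorem IsSlice.nodeSet (hc : ∀ r (R : L.Relations r), IsCongruence (c r R))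
    {X Y : Set (BinaryTree σ)} (hX : IsSlice c N X) (hY : IsSlice c N Y) (a : σ) :
    IsSlice c N (nodeSet a X Y) := by
  obtain ⟨k, typ, fill, hk, hbij, hcol⟩ := hX
  obtain ⟨k', typ', fill', -, hbij', hcol'⟩ := hY
  refine ⟨k + k', Fin.append typ typ', fun x => .node a (fill fun j => x (Fin.castAdd k' j))
    (fill' fun j => x (Fin.natAdd k j)), by omega, ⟨?_, ?_, ?_⟩, ?_⟩
  · intro x hx
    refine ⟨_, hbij.mapsTo fun j => ?_, _, hbij'.mapsTo fun j => ?_, rfl⟩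
    · simpa using hx (Fin.castAdd k' j)
    · simpa using hx (Fin.natAdd k j)
  · intro x hx y hy h
    obtain ⟨-, h₁, h₂⟩ := BinaryTree.node.inj h
    have e₁ := hbij.injOn (fun j => by simpa using hx (Fin.castAdd k' j))
      (fun j => by simpa using hy (Fin.castAdd k' j)) h₁
    have e₂ := hbij'.injOn (fun j => by simpa using hx (Fin.natAdd k j))
      (fun j => by simpa using hy (Fin.natAdd k j)) h₂
    funext j
    exact Fin.addCases (congrFun e₁) (congrFun e₂) j
  · rintro _ ⟨l, hl, r, hr, rfl⟩
    obtain ⟨x, hx, rfl⟩ := hbij.surjOn hl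
    obtain ⟨y, hy, rfl⟩ := hbij'.surjOn hr
    refine ⟨Fin.append x y, fun j => ?_, by simp⟩
    refine Fin.addCases (fun j => ?_) (fun j => ?_) j
    · simpa using hx j
    · simpa using hy j
  · intro r R x x' h
    exact hc r R _ _ (fun _ => rfl) (hcol r R _ _ fun j => h _) (hcol' r R _ _ fun j => h _)

/-- For fixed parameters, the trees fall into finitely many slices on each of which the value of a
congruence is constant. -/
theorem exists_slices [Finite σ] [Finite I] {ι Q' : Type} [Finite ι]
    (hc : ∀ r (R : L.Relations r), IsCongruence (c r R))
    {f : (Option ι → BinaryTree σ) → Q'} (hf : IsCongruence f)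
    (hnil : ∀ t, N t = N .nil → t = .nil)
    (hN : ∀ t t', N t = N t' → f (extend t fun _ => .nil) = f (extend t' fun _ => .nil))
    (s : ι → BinaryTree σ) :
    ∃ P : Set (Set (BinaryTree σ)), P.Finite ∧ (∀ X ∈ P, IsSlice c N X) ∧
      (∀ t, ∃ X ∈ P, t ∈ X) ∧ (∀ X ∈ P, ∀ Y ∈ P, ∀ t ∈ X, t ∈ Y → X = Y) ∧
      ∀ X ∈ P, ∀ t ∈ X, ∀ t' ∈ X, f (extend t s) = f (extend t' s) := by
  obtain ⟨h, hh⟩ : ∃ h, ∀ i, (s i).height ≤ h :=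
    let ⟨h, hh⟩ := (Set.finite_range fun i => (s i).height).bddAbove
    ⟨h, fun i => hh ⟨i, rfl⟩⟩
  -- With bound zero all parameters are empty, and `hN` makes `f` constant on the classes of `N`.
  induction h generalizing s with
  | zero =>
    have hs : s = fun _ => .nil := by
      funext i
      have := hh i
      cases hi : s i <;> simp_all
    subst hs
    refine ⟨Set.range fun i : I => {t | some (N t) = some i}, Set.finite_range _, ?_, ?_, ?_, ?_⟩
    · rintro _ ⟨i, rfl⟩
      exact isSlice_class c N (some i)
    · exact fun t => ⟨_, ⟨N t, rfl⟩, rfl⟩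
    · rintro _ ⟨i, rfl⟩ _ ⟨j, rfl⟩ t hi hj
      have hij : some i = some j := (show some (N t) = some i from hi).symm.trans hj
      rw [Option.some.inj hij]
    · rintro _ ⟨i, rfl⟩ t ht t' ht'
      exact hN t t' (Option.some.inj ((show some (N t) = some i from ht).trans
        (show some (N t') = some i from ht').symm))
  | succ h ih =>
    have hsub : ∀ i, (s i).left.height ≤ h ∧ (s i).right.height ≤ h := by
      intro i
      have := hh i
      cases hi : s i with
      | nil => simp
      | node a l r =>
        rw [hi] at this
        simp only [BinaryTree.height, BinaryTree.left, BinaryTree.right] at this ⊢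
        omega
    obtain ⟨Pl, fl, sl, cl, dl, el⟩ := ih _ fun i => (hsub i).1
    obtain ⟨Pr, fr, sr, cr, dr, er⟩ := ih _ fun i => (hsub i).2
    have hnilClass : ∀ t, t ∈ {t | some (N t) = some (N .nil)} ↔ t = .nil := fun t =>
      ⟨fun ht => hnil t (Option.some.inj ht), fun ht => congrArg (some ∘ N) ht⟩
    -- The empty tree is a class of `N` by `hnil`. The other slices combine a root label with a
    -- slice for the left and one for the right subtrees of the parameters.
    refine ⟨insert {t | some (N t) = some (N .nil)}
      ((fun p : σ × Set (BinaryTree σ) × Set (BinaryTree σ) => TreeAut.nodeSet p.1 p.2.1 p.2.2) ''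
        (Set.univ ×ˢ Pl ×ˢ Pr)), ((Set.finite_univ.prod (fl.prod fr)).image _).insert _,
      ?_, ?_, ?_, ?_⟩
    · rintro _ (rfl | ⟨⟨a, X, Y⟩, ⟨-, hX, hY⟩, rfl⟩)
      · exact isSlice_class c N _
      · exact (sl X hX).nodeSet hc (sr Y hY) a
    · intro t
      cases t with
      | nil => exact ⟨_, Or.inl rfl, rfl⟩
      | node a l r =>
        obtain ⟨X, hX, hl⟩ := cl l
        obtain ⟨Y, hY, hr⟩ := cr r
        exact ⟨_, Or.inr ⟨⟨a, X, Y⟩, ⟨trivial, hX, hY⟩, rfl⟩, l, hl, r, hr, rfl⟩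
    · rintro _ (rfl | ⟨⟨a, X, Y⟩, ⟨-, hX, hY⟩, rfl⟩) _ (rfl | ⟨⟨a', X', Y'⟩, ⟨-, hX', hY'⟩, rfl⟩)
        t ht ht'
      · rfl
      · obtain rfl := (hnilClass t).1 ht
        obtain ⟨l, -, r, -, h⟩ := ht'
        cases h
      · obtain rfl := (hnilClass t).1 ht'
        obtain ⟨l, -, r, -, h⟩ := ht
        cases h
      · obtain ⟨l, hl, r, hr, rfl⟩ := ht
        obtain ⟨l', hl', r', hr', h⟩ := ht'
        obtain ⟨rfl, rfl, rfl⟩ := BinaryTree.node.inj h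
        rw [dl X hX X' hX' l hl hl', dr Y hY Y' hY' r hr hr']
    · rintro _ (rfl | ⟨⟨a, X, Y⟩, ⟨-, hX, hY⟩, rfl⟩) t ht t' ht'
      · rw [(hnilClass t).1 ht, (hnilClass t').1 ht']
      · obtain ⟨l, hl, r, hr, rfl⟩ := ht
        obtain ⟨l', hl', r', hr', rfl⟩ := ht'
        exact hf.extend_eq rfl (fun _ => rfl) (el X hX l hl l' hl') (er Y hY r hr r' hr')

end Slices

/-! ### Tame box augmentations from slices -/

theorem isColouring_of_determines {L : FirstOrder.Language.{u, v}} {B : Type*} [L.Structure B] {r : ℕ} {R : L.Relations r}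
    {C : Type*} [Finite C] {d : (Fin r → B) → C}
    (h : ∀ t t', d t = d t' → Language.Structure.RelMap R t → Language.Structure.RelMap R t') :
    IsColouring R d := by
  refine ⟨inferInstance, fun t => ⟨?_, fun ht => ⟨t, ht, rfl⟩⟩⟩
  rintro ⟨t', ht', e⟩
  exact h t' t e ht'

section Components

variable {L : FirstOrder.Language.{u, v}} [L.IsRelational] {σ : Type} {I : Type}
  {Q : ∀ r, L.Relations r → Type}
  (c : ∀ r (R : L.Relations r), (Fin r → BinaryTree σ) → Q r R) (N : BinaryTree σ → I)

/-- The structure on a class of `N` (or on the empty set) in which a relation holds if the colour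
of a tuple belongs to a given set. -/
def component (p : Option I × ∀ R : Σ r, L.Relations r, Set (Q R.1 R.2)) :
    CategoryTheory.Bundled.{w} L.Structure where
  α := ULift.{w} {t : BinaryTree σ // some (N t) = p.1}
  str :=
    { funMap := fun f => isEmptyElim f
      RelMap := fun {r} R x => c r R (fun i => (x i).down.1) ∈ p.2 ⟨r, R⟩ }

variable {c N}

theorem component_isTreeAutomatic [Finite σ] [Finite I] [∀ r R, Finite (Q r R)]
    (hc : ∀ r (R : L.Relations r), IsCongruence (c r R))
    (hN : IsCongruence fun t : Unit → BinaryTree σ => N (t ()))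
    (p : Option I × ∀ R : Σ r, L.Relations r, Set (Q R.1 R.2)) :
    IsTreeAutomatic L (component.{u, v, w} c N p) := by
  obtain ⟨M, hM⟩ := exists_automaton N (fun a l r l' r' hl hr =>
    hN (fun _ => .node a l r) (fun _ => .node a l' r') (fun _ => rfl) hl hr)
    {i | some i = p.1}
  have hreg : ∀ {r : ℕ} (R : L.Relations r), IsRegular
      ((fun x : Fin r → component.{u, v, w} c N p => (fun a => a.down.1) ∘ x) ''
        {x | Language.Structure.RelMap R x}) := by
    intro r R
    refine ⟨_, inferInstance, _, {q | (∀ k, some (q.1 k) = p.1) ∧ q.2 ∈ p.2 ⟨r, R⟩},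
      (IsCongruence.pi fun k : Fin r => hN.comp fun _ => k).prodMk (hc r R), ?_⟩
    ext t
    constructor
    · rintro ⟨x, hx, rfl⟩
      exact ⟨fun k => (x k).down.2, hx⟩
    · rintro ⟨h₁, h₂⟩
      exact ⟨fun k => ⟨⟨t k, h₁ k⟩⟩, h₂, rfl⟩
  choose MR hMR using fun {r : ℕ} (R : L.Relations r) => (hreg R).exists_recognises
  refine ⟨σ, inferInstance, M, MR, fun a => a.down.1, ⟨?_, ?_, ?_⟩, hMR⟩
  · intro a _
    rw [hM]
    exact a.down.2
  · intro a _ b _ h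
    exact ULift.ext _ _ (Subtype.ext h)
  · intro t ht
    rw [hM] at ht
    exact ⟨⟨⟨t, ht⟩⟩, trivial, rfl⟩

/-- Varying only coordinate `j` leaves constant tuples in the other coordinates, and by `hN` their
colours depend only on the class. Hence the relation induced on factor `j` is independent of the
fixed entries. -/
theorem IsSlice.exists_isTameBoxAugmentation [∀ r R, Finite (Q r R)]
    (hN : ∀ r (R : L.Relations r) t t', N t = N t' → c r R (fun _ => t) = c r R fun _ => t')
    {X : Set (BinaryTree σ)} (hX : IsSlice c N X) {C : Type w} [L.Structure C]
    {ν : C → BinaryTree σ} (hν : Set.BijOn ν Set.univ X)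
    (acc : ∀ r (R : L.Relations r), Set (Q r R))
    (hacc : ∀ r (R : L.Relations r) (x : Fin r → C),
      Language.Structure.RelMap R x ↔ c r R (fun i => ν (x i)) ∈ acc r R) :
    ∃ (k : ℕ) (D : Fin k → CategoryTheory.Bundled.{w} L.Structure), 0 < k ∧
      (∀ i, D i ∈ Set.range (component.{u, v, w} c N)) ∧
      IsTameBoxAugmentation L C (fun i => D i) := by
  obtain ⟨k, typ, fill, hk, hbij, hcol⟩ := hX
  -- The colours that are accepted in coordinate `j` for some choice of the other entries; `key`
  -- shows that any choice gives the same answer.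
  let F : Fin k → ∀ R : Σ r, L.Relations r, Set (Q R.1 R.2) := fun j R =>
    {q | ∃ (b : Fin R.1 → BinaryTree σ) (y : Fin k → BinaryTree σ),
      (∀ i, some (N (y i)) = typ i) ∧ c R.1 R.2 b = q ∧
      c R.1 R.2 (fun i => fill (Function.update y j (b i))) ∈ acc R.1 R.2}
  have key : ∀ (j : Fin k) {r : ℕ} (R : L.Relations r) (b : Fin r → BinaryTree σ)
      (y : Fin k → BinaryTree σ), (∀ i, some (N (y i)) = typ i) →
      (c r R b ∈ F j ⟨r, R⟩ ↔ c r R (fun i => fill (Function.update y j (b i))) ∈ acc r R) := by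
    intro j r R b y hy
    refine ⟨?_, fun h => ⟨b, y, hy, rfl, h⟩⟩
    rintro ⟨b', y', hy', hb, h⟩
    rwa [hcol r R (fun i => Function.update y j (b i)) (fun i => Function.update y' j (b' i))]
    intro j'
    by_cases hj : j' = j
    · subst hj
      simpa using hb.symm
    · simp only [Function.update_of_ne hj]
      exact hN r R _ _ (Option.some.inj ((hy j').trans (hy' j').symm))
  let D : Fin k → CategoryTheory.Bundled.{w} L.Structure := fun j => component c N (typ j, F j)
  let val : (∀ j, D j) → Fin k → BinaryTree σ := fun x j => (x j).down.1
  have hval : ∀ x j, some (N (val x j)) = typ j := fun x j => (x j).down.2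
  have hupd : ∀ (x : ∀ j, D j) j (b : D j),
      val (Function.update x j b) = Function.update (val x) j b.down.1 := by
    intro x j b
    funext j'
    by_cases hj : j' = j
    · subst hj
      simp [val]
    · simp [val, Function.update_of_ne hj]
  choose f₀ hf₀ using fun x : ∀ j, D j => hν.surjOn (hbij.mapsTo (hval x))
  have hf₀ : ∀ x, ν (f₀ x) = fill (val x) := fun x => (hf₀ x).2
  have hbijf : Function.Bijective f₀ := by
    constructor
    · intro x y h
      have := hbij.injOn (hval x) (hval y) (by rw [← hf₀, ← hf₀, h])
      funext j
      exact ULift.ext _ _ (Subtype.ext (congrFun this j))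
    · intro a
      obtain ⟨y, hy, h⟩ := hbij.surjOn (hν.mapsTo (Set.mem_univ a))
      refine ⟨fun j => ⟨⟨y j, hy j⟩⟩, hν.injOn trivial trivial ?_⟩
      exact (hf₀ _).trans h
  let f : (∀ j, D j) ≃ C := Equiv.ofBijective f₀ hbijf
  have hf : ∀ a, ν a = fill (val (f.symm a)) := fun a => by
    rw [← hf₀]
    exact congrArg ν (f.apply_symm_apply a).symm
  refine ⟨k, D, hk, fun j => ⟨_, rfl⟩, f, ?_, ?_⟩
  · intro j x
    refine ⟨⟨⟨fun b => f (Function.update x j b), ?_⟩, fun g => isEmptyElim g, ?_⟩, fun b => rfl⟩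
    · exact f.injective.comp (Function.update_injective x j)
    · intro r R b
      have h := key j R (fun i => (b i).down.1) (val x) (hval x)
      refine (hacc r R _).trans (Iff.trans ?_ h.symm)
      refine iff_of_eq (congrArg (fun z => c r R z ∈ acc r R) (funext fun i => ?_))
      exact (hf₀ _).trans (congrArg fill (hupd x j (b i)))
  · intro r R
    -- The automaton states themselves serve as colours in each coordinate.
    refine ⟨fun _ => Q r R, fun j t => c r R fun i => (t i).down.1, fun j => ?_, ?_⟩
    · refine isColouring_of_determines fun t t' h ht => ?_
      exact Eq.subst (motive := fun q => q ∈ F j ⟨r, R⟩) h ht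
    · refine isColouring_of_determines fun t t' h ht => ?_
      rw [hacc] at ht ⊢
      simp only [hf] at ht ⊢
      rwa [← hcol r R (fun i => val (f.symm (t i))) (fun i => val (f.symm (t' i)))]
      exact fun j => congrFun h j

end Components
-- The finite invariant `N` and the proof of the theorem.
theorem IsCongruence.injective_comp {σ ι Q Q' : Type*} {f : (ι → BinaryTree σ) → Q}
    (hf : IsCongruence f) {e : Q → Q'} (he : Function.Injective e) :
    IsCongruence fun t => e (f t) :=
  fun t t' h hl hr => congrArg e (hf t t' h (he hl) (he hr))

theorem IsCongruence.extend_nil {σ ι Q : Type*} {f : (Option ι → BinaryTree σ) → Q}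
    (hf : IsCongruence f) :
    IsCongruence fun t : Unit → BinaryTree σ => f (extend (t ()) fun _ => .nil) :=
  fun _ _ h hl hr => hf.extend_eq (h ()) (fun _ => rfl) hl hr

end TreeAut

theorem mainTheorem5 (L : FirstOrder.Language.{u, v}) [L.IsRelational]
    [Finite (Σ r, L.Relations r)] [IsEmpty (L.Relations 0)]
    (A : Type w) [L.Structure A] (hA : TreeAut.IsTreeAutomatic L A)
    (n : ℕ) (φ : TreeAut.InfFormula L (Fin (n + 1)) 0) :
    ∃ S : Set (CategoryTheory.Bundled.{w} L.Structure), S.Finite ∧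
      (∀ B ∈ S, TreeAut.IsTreeAutomatic L B) ∧
      ∀ s : Fin n → A, ∃ (m : ℕ) (C : Fin m → CategoryTheory.Bundled.{w} L.Structure), 0 < m ∧
        TreeAut.IsSumAugmentation L (TreeAut.induced L (φ.defSet s)) (fun j => C j) ∧
        ∀ j, ∃ (k : ℕ) (D : Fin k → CategoryTheory.Bundled.{w} L.Structure), 0 < k ∧
          (∀ i, D i ∈ S) ∧ TreeAut.IsTameBoxAugmentation L (C j) (fun i => D i) := by
  open TreeAut in
  obtain ⟨σ, hσ, M, MR, μ, hμ, hMR⟩ := hA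
  have hinj : Function.Injective μ := Set.injOn_univ.1 hμ.injOn
  obtain ⟨X, hX, hφ⟩ := φ.exists_isRegular hμ fun R => (hMR R).isRegular
  -- the relation that `φ` defines on names, with the variable `x` at index `none`
  let g : Fin (n + 1) ⊕ Fin 0 → Option (Fin n) :=
    Sum.elim (Fin.cons none some) Fin.elim0
  obtain ⟨Q', hQ', f, F, hf, hF⟩ := (M.isRegular_language none).inter (hX.comap g)
  have hdef : ∀ (s : Fin n → A) t, f (extend t fun i => μ (s i)) ∈ F ↔
      ∃ a ∈ φ.defSet s, μ a = t := by
    intro s t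
    have hg : ∀ a, (fun i => extend (μ a) (fun i => μ (s i)) (g i)) = fun i =>
        μ (Sum.elim (Fin.cons a s : Fin (n + 1) → A) Fin.elim0 i) := by
      intro a
      funext i
      rcases i with i | i
      · refine Fin.cases ?_ (fun i => ?_) i <;> simp [extend, g]
      · exact i.elim0
    rw [← Set.mem_preimage, ← hF]
    constructor
    · rintro ⟨ht, hXt⟩
      obtain ⟨a, -, rfl⟩ := hμ.surjOn ht
      refine ⟨a, (hφ _ _).1 ?_, rfl⟩
      rw [← hg]
      exact hXt
    · rintro ⟨a, ha, rfl⟩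
      refine ⟨hμ.mapsTo trivial, ?_⟩
      have := (hφ _ _).2 ha
      rw [← hg] at this
      exact this
  let c : ∀ r (R : L.Relations r), (Fin r → BinaryTree σ) → (MR R).State :=
    fun r R t => (MR R).run (conv t)
  have hc : ∀ r (R : L.Relations r), IsCongruence (c r R) := fun r R =>
    (MR R).isCongruence_conv
  have : ∀ r (R : L.Relations r), Finite (MR R).State := fun r R => (MR R).finite_state
  have hrel : ∀ r (R : L.Relations r) (x : Fin r → A),
      Language.Structure.RelMap R x ↔ c r R (fun i => μ (x i)) ∈ (MR R).accept := by
    intro r R x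
    rw [(hMR R).run_mem_iff]
    exact (hinj.comp_left.mem_set_image (f := fun x : Fin r → A => μ ∘ x)).symm
  -- The three entries serve, in order, to isolate the empty tree, to determine `f` below the
  -- parameters, and to fix the colours of constant tuples.
  let N₀ : BinaryTree σ → Prop × Q' × ∀ R : Σ r, L.Relations r, (MR R.2).State := fun t =>
    (t = .nil, f (extend t fun _ => .nil), fun R => c R.1 R.2 fun _ => t)
  have hN₀ : IsCongruence fun t : Unit → BinaryTree σ => N₀ (t ()) :=
    (isCongruence_eq_nil ()).prodMk (hf.extend_nil.prodMk
      (IsCongruence.pi fun R => (hc R.1 R.2).comp fun _ => ()))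
  obtain ⟨p, ⟨e⟩⟩ :=
    Finite.exists_equiv_fin (Prop × Q' × ∀ R : Σ r, L.Relations r, (MR R.2).State)
  let N : BinaryTree σ → Fin p := fun t => e (N₀ t)
  have hN : ∀ t t', N t = N t' → N₀ t = N₀ t' := fun t t' h => e.injective h
  -- This family depends on the presentation and `φ` but not on `s`; it is indexed by finitely many
  -- classes and sets of states.
  refine ⟨Set.range (component.{u, v, w} c N), Set.finite_range _, ?_, fun s => ?_⟩
  · rintro _ ⟨q, rfl⟩
    exact component_isTreeAutomatic hc (hN₀.injective_comp e.injective) q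
  obtain ⟨P, hPfin, hPslice, hPcover, hPdisj, hPconst⟩ := exists_slices (N := N) hc hf
    (fun t h => of_eq_true ((congrArg Prod.fst (hN _ _ h)).trans (eq_true rfl)))
    (fun t t' h => congrArg (fun q => q.2.1) (hN _ _ h)) fun i => μ (s i)
  -- add the empty slice, so that the sum has at least one summand
  let P' : Set (Set (BinaryTree σ)) :=
    insert ∅ {X ∈ P | ∀ t ∈ X, f (extend t fun i => μ (s i)) ∈ F}
  have hP'fin : Finite P' := ((hPfin.subset (Set.sep_subset _ _)).insert ∅).to_subtype
  have hP'slice : ∀ X ∈ P', IsSlice c N X := by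
    rintro X (rfl | ⟨hX, -⟩)
    · convert isSlice_class c N none using 1
      ext t
      simp
    · exact hPslice X hX
  have hP'mem : ∀ X ∈ P', ∀ t ∈ X, ∃ a ∈ φ.defSet s, μ a = t := by
    rintro X (rfl | ⟨-, hX⟩) t ht
    · exact absurd ht (Set.notMem_empty t)
    · exact (hdef s t).1 (hX t ht)
  have hP'disj : ∀ X ∈ P', ∀ Y ∈ P', ∀ t ∈ X, t ∈ Y → X = Y := by
    rintro X (rfl | ⟨hX, -⟩) Y (rfl | ⟨hY, -⟩) t htX htY
    · rfl
    · exact absurd htX (Set.notMem_empty t)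
    · exact absurd htY (Set.notMem_empty t)
    · exact hPdisj X hX Y hY t htX htY
  have hP'cover : ∀ a ∈ φ.defSet s, ∃ X ∈ P', μ a ∈ X := by
    intro a ha
    obtain ⟨X, hX, haX⟩ := hPcover (μ a)
    refine ⟨X, Or.inr ⟨hX, fun t ht => ?_⟩, haX⟩
    -- By constancy of `f`, a slice meeting the definable set consists only of names of its
    -- elements.
    rw [hPconst X hX t ht _ haX]
    exact (hdef s _).2 ⟨a, ha, rfl⟩
  obtain ⟨m, ⟨eP⟩⟩ := Finite.exists_equiv_fin P'
  let B : Fin m → Set (induced L (φ.defSet s)) := fun j => {a | μ a.1 ∈ (eP.symm j).1}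
  refine ⟨m, fun j => ⟨induced L (B j), inferInstance⟩, ?_, ⟨B, ?_, ?_, fun j => ⟨.refl L _⟩⟩,
    fun j => ?_⟩
  · exact Fin.pos (eP ⟨∅, Or.inl rfl⟩)
  · intro i j hij
    refine Set.disjoint_left.2 fun a hi hj => hij (eP.symm.injective (Subtype.ext ?_))
    exact hP'disj _ (eP.symm i).2 _ (eP.symm j).2 _ hi hj
  · refine Set.eq_univ_of_forall fun a => ?_
    obtain ⟨X, hX, haX⟩ := hP'cover a.1 a.2
    refine Set.mem_iUnion.2 ⟨eP ⟨X, hX⟩, ?_⟩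
    change μ a.1 ∈ (eP.symm (eP ⟨X, hX⟩)).1
    rwa [eP.symm_apply_apply]
  · refine (hP'slice _ (eP.symm j).2).exists_isTameBoxAugmentation
      (fun r R t t' h => congrFun (congrArg (fun q => q.2.2) (hN _ _ h)) ⟨r, R⟩)
      (ν := fun a : induced L (B j) => μ a.1.1) ⟨fun a _ => a.2, ?_, ?_⟩
      (fun r R => (MR R).accept) (fun r R x => hrel r R _)
    · exact fun a _ b _ h => Subtype.ext (Subtype.ext (hinj h))
    · intro t ht
      obtain ⟨a, ha, rfl⟩ := hP'mem _ (eP.symm j).2 t ht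
      exact ⟨⟨⟨a, ha⟩, ht⟩, trivial, rfl⟩
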